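/- Let $\rho>0$. For $\alpha>0$ and $a,b\ge 0$ consider the system on $\mathbb{R}$, for real-valued $U,V$, $$U''+U^3-\alpha(V+\rho)U=0,\qquad (aV^2-bV^3)'=\alpha(U^2)'.\tag{S}$$ A solution means a pair $(U,V)$ with $U$ of class $C^2$ and $V$ continuous that satisfies (S) at every point of $\mathbb{R}$ (the second equation includes differentiability of $aV^2-bV^3$) and such that $U(x),V(x)\to0$ as $|x|\to\infty$. Let $H^1_{rd}(\mathbb{R})$ be the set of functions in $H^1(\mathbb{R})$ which are even and decreasing (in the wide sense) in $|x|$. 1. Let $\alpha>0$, $a=0$ and $b>0$. Then (S) admits a solution $(U,V)$ with $U\in H^1_{rd}(\mathbb{R})$ positive and $V=-\left(\frac{\alpha}{b}\right)^{1/3}U^{2/3}$. 2. Let $\alpha>0$, $a>0$ and $b=0$. Then (S) admits two solutions $(U_1,V_1)$ and $(U_2,V_2)$ with $U_1,U_2\in H^1_{rd}(\mathbb{R})$ positive, $V_1=-\left(\frac{\alpha}{a}\right)^{1/2}U_1$ and $V_2=\left(\frac{\alpha}{a}\right)^{1/2}U_2$. 3. Let $a,b>0$. Then there is $\alpha_0>0$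 (depending on $\rho,a,b$) such that for every $0<\alpha<\alpha_0$ the system (S) admits two solutions $(U_1,V_1)$ and $(U_2,V_2)$ with $U_1,U_2\in H^1(\mathbb{R})$, everywhere $U_1>0$, $V_1>0$, $U_2>0$, $V_2<0$, and $aV_i^2-bV_i^3=\alpha U_i^2$ on $\mathbb{R}$ for $i=1,2$. -/

import Mathlib

open MeasureTheory Filter Topology
open scoped ContDiff

/-- `W` is a weak derivative of `U` on `ℝ`: integration by parts holds against every smooth
compactly supported test function. (Used for square integrable `U` and `W`, so that both
integrands are integrable.) -/
def IsWeakDeriv (U W : ℝ → ℝ) : Prop :=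
  ∀ φ : ℝ → ℝ, ContDiff ℝ ∞ φ → HasCompactSupport φ →
    ∫ x, U x * deriv φ x = -∫ x, W x * φ x

/-- The Sobolev space `H¹(ℝ)` of real-valued functions. -/
def MemH1 (U : ℝ → ℝ) : Prop :=
  MemLp U 2 volume ∧ ∃ W : ℝ → ℝ, MemLp W 2 volume ∧ IsWeakDeriv U W

/-- The set `H¹_rd(ℝ)` of functions in `H¹(ℝ)` which are even and decreasing in `|x|`. -/
def MemH1rd (U : ℝ → ℝ) : Prop :=
  MemH1 U ∧ (∀ x, U (-x) = U x) ∧ ∀ x y, |x| ≤ |y| → U y ≤ U x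

/-- `(U, V)` is a (classical) solution on `ℝ`, vanishing at infinity, of the system
`U'' + U³ - α (V + ρ) U = 0`, `(a V² - b V³)' = α (U²)'`. -/
structure IsBoundState (ρ α a b : ℝ) (U V : ℝ → ℝ) : Prop where
  contDiff_fst : ContDiff ℝ 2 U
  continuous_snd : Continuous V
  schrodinger : ∀ x, deriv (deriv U) x + U x ^ 3 - α * (V x + ρ) * U x = 0
  conservation : ∀ x, HasDerivAt (fun y => a * V y ^ 2 - b * V y ^ 3)
    (α * deriv (fun y => U y ^ 2) x) x
  tendsto_fst : Tendsto U (cocompact ℝ) (𝓝 0)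
  tendsto_snd : Tendsto V (cocompact ℝ) (𝓝 0)

/-! Decay at infinity suggests integrating the second equation to `aV² - bV³ = αU²`. On a branch `V
= v(U)` the system becomes `U'' = p(U) U` with `p(s) = α(ρ + v(s)) - s²`. At zero energy this reads
`U'² = 2 U² P(U)`, where `P` is `reducedPotential p` and `P(0) = αρ/2 > 0`. A homoclinic orbit
exists if the first positive zero `u₀` of `P` is nondegenerate, that is `p(u₀) < 0`.

The orbit is found by writing `U = u₀ / cosh² θ`, which absorbs both the turning point and the
decay: `θ` solves `θ' = k(θ)` with `k` even and bounded between positive constants, so inverting `∫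
1/k` gives a global odd `θ`. Evenness, monotonicity and membership in `H¹` are then read off from
`cosh`.

The branch is an explicit power law if `a` or `b` vanishes. If both are positive it is a local
inverse near zero, and small `α` keeps the orbit within its range. -/

/-! ### Autonomous scalar equations -/

/-- An even continuous velocity field bounded between positive constants has an odd global
integral curve, which moves at least at the minimal speed. -/
theorem exists_odd_integral_curve {k : ℝ → ℝ} (hk : Continuous k) (heven : ∀ y, k (-y) = k y)
    {c C : ℝ} (hc : 0 < c) (hck : ∀ y, c ≤ k y) (hkC : ∀ y, k y ≤ C) :
    ∃ θ : ℝ → ℝ, (∀ x, HasDerivAt θ (k (θ x)) x) ∧ (∀ x, θ (-x) = -θ x) ∧ StrictMono θ ∧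
      ∀ x, c * |x| ≤ |θ x| := by
  have hkpos : ∀ y, 0 < k y := fun y => hc.trans_le (hck y)
  have hC : 0 < C := (hkpos 0).trans_le (hkC 0)
  have hki : Continuous fun y => (k y)⁻¹ := hk.inv₀ fun y => (hkpos y).ne'
  set T : ℝ → ℝ := fun y => ∫ t in (0 : ℝ)..y, (k t)⁻¹ with hT
  have hTd : ∀ y, HasDerivAt T (k y)⁻¹ y := fun y =>
    intervalIntegral.integral_hasDerivAt_right (hki.intervalIntegrable _ _)
      (hki.stronglyMeasurableAtFilter _ _) hki.continuousAt
  have hTcont : Continuous T := continuous_iff_continuousAt.2 fun y => (hTd y).continuousAt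
  have hTmono : StrictMono T := strictMono_of_deriv_pos fun y => by
    rw [(hTd y).deriv]; exact inv_pos.2 (hkpos y)
  have hT0 : T 0 = 0 := by simp [hT]
  have hTodd : ∀ y, T (-y) = -T y := by
    intro y
    have h := intervalIntegral.integral_comp_neg (a := 0) (b := y) fun t => (k t)⁻¹
    simp only [heven, neg_zero] at h
    simp only [hT]
    rw [h, intervalIntegral.integral_symm]
  -- Since `1/k ≥ 1/C`, `T` grows at least linearly; this makes it onto.
  have hDm : Monotone fun y => T y - y / C := by
    have hd : ∀ y, HasDerivAt (fun y => T y - y / C) ((k y)⁻¹ - 1 / C) y := fun y =>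
      (hTd y).sub ((hasDerivAt_id y).div_const C)
    refine monotone_of_deriv_nonneg (fun y => (hd y).differentiableAt) fun y => ?_
    rw [(hd y).deriv, sub_nonneg, one_div]
    exact inv_anti₀ (hkpos y) (hkC y)
  have hTsurj : Function.Surjective T := by
    refine hTcont.surjective ?_ ?_
    · refine tendsto_atTop_mono' _ ?_ (tendsto_id.atTop_div_const hC)
      filter_upwards [eventually_ge_atTop 0] with y hy
      have := hDm hy
      simp only [hT0, zero_div, sub_zero] at this
      simpa using this
    · refine tendsto_atBot_mono' _ ?_ (tendsto_id.atBot_div_const hC)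
      filter_upwards [eventually_le_atBot 0] with y hy
      have := hDm hy
      simp only [hT0, zero_div, sub_zero] at this
      simpa using this
  let e := hTmono.orderIsoOfSurjective T hTsurj
  have heT : ∀ x, T (e.symm x) = x := fun x =>
    hTmono.orderIsoOfSurjective_self_symm_apply T hTsurj x
  refine ⟨e.symm, fun x => ?_, fun x => ?_, e.symm.strictMono, fun x => ?_⟩
  · have := HasDerivAt.of_local_left_inverse (f := T) (g := e.symm) (a := x)
      e.symm.continuous.continuousAt (hTd _) (inv_ne_zero (hkpos _).ne')
      (Eventually.of_forall heT)
    simpa using this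
  · apply hTmono.injective
    rw [heT, hTodd, heT]
  · have h := intervalIntegral.norm_integral_le_of_norm_le_const (a := 0) (b := e.symm x)
      (f := fun t => (k t)⁻¹) (C := c⁻¹) fun t _ => by
        rw [Real.norm_eq_abs, abs_of_pos (inv_pos.2 (hkpos t))]
        exact inv_anti₀ hc (hck t)
    have h2 : |x| ≤ c⁻¹ * |e.symm x| := by
      have h3 : ‖T (e.symm x)‖ ≤ c⁻¹ * |e.symm x - 0| := h
      rwa [heT, sub_zero, Real.norm_eq_abs] at h3
    calc c * |x| ≤ c * (c⁻¹ * |e.symm x|) := by gcongr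
      _ = |e.symm x| := by field_simp

/-! ### Membership in `H¹` -/

/-- The classical derivative is a weak derivative. -/
theorem isWeakDeriv_of_hasDerivAt {U W : ℝ → ℝ} (hU : ∀ x, HasDerivAt U (W x) x)
    (hW : Continuous W) : IsWeakDeriv U W := by
  intro φ hφ hc
  have hUc : Continuous U := continuous_iff_continuousAt.2 fun x => (hU x).continuousAt
  have hφ' : Continuous (deriv φ) := hφ.continuous_deriv (by simp)
  refine integral_mul_deriv_eq_deriv_mul_of_integrable (fun x _ => hU x)
    (fun x _ => (hφ.differentiable (by simp) x).hasDerivAt) ?_ ?_ ?_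
  · exact (hUc.mul hφ').integrable_of_hasCompactSupport hc.deriv.mul_left
  · exact (hW.mul hφ.continuous).integrable_of_hasCompactSupport hc.mul_left
  · exact (hUc.mul hφ.continuous).integrable_of_hasCompactSupport hc.mul_left

theorem memLp_two_of_abs_le_inv_one_add_sq {f : ℝ → ℝ} (hf : Continuous f) {A c : ℝ}
    (hc : 0 < c) (hle : ∀ x, |f x| ≤ A * (1 + (c * x) ^ 2)⁻¹) : MemLp f 2 volume := by
  rw [memLp_two_iff_integrable_sq hf.aestronglyMeasurable]
  refine ((integrable_inv_one_add_sq.comp_mul_left' hc.ne').const_mul (A ^ 2)).mono'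
    (hf.pow 2).aestronglyMeasurable (Eventually.of_forall fun x => ?_)
  rw [Real.norm_eq_abs, abs_pow]
  have h1 : (1 + (c * x) ^ 2)⁻¹ ≤ 1 := inv_le_one_of_one_le₀ (by nlinarith [sq_nonneg (c * x)])
  have h0 : 0 ≤ (1 + (c * x) ^ 2)⁻¹ := by positivity
  calc |f x| ^ 2 ≤ (A * (1 + (c * x) ^ 2)⁻¹) ^ 2 := by gcongr; exact hle x
    _ = A ^ 2 * ((1 + (c * x) ^ 2)⁻¹ * (1 + (c * x) ^ 2)⁻¹) := by ring
    _ ≤ A ^ 2 * (1 + (c * x) ^ 2)⁻¹ := by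
      gcongr; exact mul_le_of_le_one_right h0 h1

/-! ### The reduced potential -/

/-- For the equation `U'' = p(U) U`, the quotient of the potential `∫₀ᵘ s p(s) ds` by `u²`. -/
noncomputable def reducedPotential (p : ℝ → ℝ) (u : ℝ) : ℝ := ∫ t in (0 : ℝ)..1, t * p (t * u)

theorem continuous_reducedPotential {p : ℝ → ℝ} (hp : Continuous p) :
    Continuous (reducedPotential p) :=
  intervalIntegral.continuous_parametric_intervalIntegral_of_continuous'
    (by unfold Function.uncurry; fun_prop) 0 1

theorem reducedPotential_zero (p : ℝ → ℝ) : reducedPotential p 0 = p 0 / 2 := by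
  simp [reducedPotential, integral_id]; ring

/-- Substitute `s = t u`. The averaged form avoids dividing by `u²`, so it stays continuous at `u =
0`. -/
theorem sq_mul_reducedPotential (p : ℝ → ℝ) (u : ℝ) :
    u ^ 2 * reducedPotential p u = ∫ s in (0 : ℝ)..u, s * p s := by
  have h := intervalIntegral.smul_integral_comp_mul_right (a := 0) (b := 1)
    (fun s => s * p s) u
  simp only [zero_mul, one_mul, smul_eq_mul] at h
  rw [← h, reducedPotential, sq, mul_assoc, ← intervalIntegral.integral_const_mul]
  congr 2
  ext t
  ring

theorem hasDerivAt_sq_mul_reducedPotential {p : ℝ → ℝ} (hp : Continuous p) (u : ℝ) :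
    HasDerivAt (fun u => u ^ 2 * reducedPotential p u) (u * p u) u := by
  simp only [sq_mul_reducedPotential]
  have h : Continuous fun s => s * p s := by fun_prop
  exact intervalIntegral.integral_hasDerivAt_right (h.intervalIntegrable _ _)
    (h.stronglyMeasurableAtFilter _ _) h.continuousAt

/-- In the quotient rule for `(u² P)/u²`, the term carrying `P(u)` drops out at a zero. -/
theorem hasDerivAt_reducedPotential {p : ℝ → ℝ} (hp : Continuous p) {u : ℝ} (hu : 0 < u)
    (h0 : reducedPotential p u = 0) : HasDerivAt (reducedPotential p) (p u / u) u := by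
  have h1 := (hasDerivAt_sq_mul_reducedPotential hp u).div (hasDerivAt_pow 2 u) (by positivity)
  refine (h1.congr_of_eventuallyEq ?_).congr_deriv ?_
  · filter_upwards [lt_mem_nhds hu] with v hv
    simp [hv.ne']
  · simp only [h0]
    field_simp
    ring

/-- The first positive zero of the reduced potential. -/
theorem exists_first_zero_reducedPotential {p : ℝ → ℝ} (hp : Continuous p) (hp0 : 0 < p 0)
    {M : ℝ} (hM : 0 < M) (hPM : reducedPotential p M ≤ 0) :
    ∃ u₀, 0 < u₀ ∧ u₀ ≤ M ∧ reducedPotential p u₀ = 0 ∧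
      ∀ u, 0 ≤ u → u < u₀ → 0 < reducedPotential p u := by
  have hPc := continuous_reducedPotential hp
  have hcomp : IsCompact (Set.Icc 0 M ∩ {u | reducedPotential p u ≤ 0}) :=
    isCompact_Icc.inter_right (isClosed_le hPc continuous_const)
  obtain ⟨u₀, ⟨⟨h0, hle⟩, hP⟩, hmin⟩ := hcomp.exists_isLeast ⟨M, ⟨hM.le, le_rfl⟩, hPM⟩
  have hP0 : 0 < reducedPotential p 0 := by rw [reducedPotential_zero]; positivity
  have hpos : 0 < u₀ := by
    rcases h0.lt_or_eq with h | h
    · exact h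
    · rw [Set.mem_ofPred_eq, ← h] at hP; linarith
  have hlt : ∀ u, 0 ≤ u → u < u₀ → 0 < reducedPotential p u := by
    intro u hu huu
    by_contra! hcon
    exact absurd (hmin ⟨⟨hu, huu.le.trans hle⟩, hcon⟩) (not_le.2 huu)
  refine ⟨u₀, hpos, hle, le_antisymm hP ?_, hlt⟩
  -- `u₀` is a limit of points where `P > 0`, so `P(u₀) ≥ 0`.
  have hcl : u₀ ∈ closure (Set.Ico 0 u₀) := by
    rw [closure_Ico hpos.ne]; exact ⟨hpos.le, le_rfl⟩
  exact closure_minimal (fun u hu => (hlt u hu.1 hu.2).le)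
    (isClosed_le continuous_const hPc) hcl

/-- A continuous square root of a differentiable function is differentiable off its zeros. -/
theorem hasDerivAt_of_hasDerivAt_sq {W : ℝ → ℝ} {x w : ℝ} (hW : ContinuousAt W x)
    (hd : HasDerivAt (fun y => W y ^ 2) (2 * w * W x) x) (hx : W x ≠ 0) : HasDerivAt W w x := by
  have key : ∀ {Z : ℝ → ℝ} {z : ℝ}, ContinuousAt Z x →
      HasDerivAt (fun y => Z y ^ 2) (2 * z * Z x) x → 0 < Z x → HasDerivAt Z z x := by
    intro Z z hZ hd hpos
    have h := hd.sqrt (by positivity)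
    refine (h.congr_of_eventuallyEq ?_).congr_deriv ?_
    · filter_upwards [hZ.eventually (lt_mem_nhds hpos)] with y hy
      exact (Real.sqrt_sq hy.le).symm
    · rw [Real.sqrt_sq hpos.le]
      field_simp
  rcases hx.lt_or_gt with h | h
  · have h1 := key (Z := fun y => -W y) (z := -w) hW.neg (by simpa using hd) (by simpa using h)
    exact (h1.neg.congr_of_eventuallyEq (Eventually.of_forall fun y => by simp)).congr_deriv
      (neg_neg w)
  · exact key hW hd h

/-! ### Homoclinic orbits -/

/-- Existence of a positive even decreasing homoclinic solution of `U'' = p(U) U`, given a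
positive nondegenerate zero of its potential. -/
theorem exists_homoclinic_of_reducedPotential {p : ℝ → ℝ} (hp : Continuous p) {u₀ : ℝ}
    (hu₀ : 0 < u₀) (hP0 : reducedPotential p u₀ = 0)
    (hPpos : ∀ u, 0 ≤ u → u < u₀ → 0 < reducedPotential p u) (hpneg : p u₀ < 0) :
    ∃ U : ℝ → ℝ, ContDiff ℝ 2 U ∧ (∀ x, deriv (deriv U) x = p (U x) * U x) ∧ MemH1rd U ∧
      (∀ x, 0 < U x) ∧ (∀ x, U x ≤ u₀) ∧ Tendsto U (cocompact ℝ) (𝓝 0) := by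
  have hPc := continuous_reducedPotential hp
  have hPd := hasDerivAt_reducedPotential hp hu₀ hP0
  -- The continuous extension of `u₀ P(u) / (2(u₀ - u))`. Its value `-p(u₀)/2` at `u₀` is positive
  -- by nondegeneracy, so `K` has a positive minimum on `[0, u₀]`.
  set K : ℝ → ℝ := fun u => -(u₀ / 2) * dslope (reducedPotential p) u₀ u with hK
  have hKc : Continuous K := by
    refine continuous_const.mul (continuous_iff_continuousAt.2 fun u => ?_)
    rcases eq_or_ne u u₀ with rfl | hne
    · exact continuousAt_dslope_same.2 hPd.differentiableAt
    · exact (continuousAt_dslope_of_ne hne).2 hPc.continuousAt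
  have hK0 : K u₀ = -p u₀ / 2 := by
    simp only [hK, dslope_same, hPd.deriv]
    field_simp
  have hKne : ∀ u, u ≠ u₀ → 2 * (u₀ - u) * K u = u₀ * reducedPotential p u := by
    intro u hu
    have : u - u₀ ≠ 0 := sub_ne_zero.2 hu
    simp only [hK, dslope_of_ne _ hu, slope_def_field, hP0]
    field_simp
    ring
  have hKpos : ∀ u ∈ Set.Icc 0 u₀, 0 < K u := by
    rintro u ⟨h0, h1⟩
    rcases h1.eq_or_lt with rfl | hlt
    · rw [hK0]; linarith
    · have h2 : 0 < 2 * (u₀ - u) * K u := by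
        rw [hKne u hlt.ne]; exact mul_pos hu₀ (hPpos u h0 hlt)
      exact pos_of_mul_pos_right h2 (by linarith)
  obtain ⟨um, hum, hmin⟩ := isCompact_Icc.exists_isMinOn (Set.nonempty_Icc.2 hu₀.le)
    hKc.continuousOn
  obtain ⟨uM, huM, hmax⟩ := isCompact_Icc.exists_isMaxOn (Set.nonempty_Icc.2 hu₀.le)
    hKc.continuousOn
  set g : ℝ → ℝ := fun y => u₀ / Real.cosh y ^ 2 with hg
  have hgc : Continuous g :=
    continuous_const.div (Real.continuous_cosh.pow 2) fun y => (pow_pos (Real.cosh_pos y) 2).ne'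
  have hgpos : ∀ y, 0 < g y := fun y => by have := Real.cosh_pos y; positivity
  have hgle : ∀ y, g y ≤ u₀ := fun y =>
    div_le_self hu₀.le (one_le_pow₀ (Real.one_le_cosh y))
  have hgmem : ∀ y, g y ∈ Set.Icc 0 u₀ := fun y => ⟨(hgpos y).le, hgle y⟩
  set k : ℝ → ℝ := fun y => √(K (g y)) with hk
  have hkc : Continuous k := (hKc.comp hgc).sqrt
  set c := √(K um) with hc
  have hcpos : 0 < c := Real.sqrt_pos.2 (hKpos um hum)
  have hck : ∀ y, c ≤ k y := fun y => Real.sqrt_le_sqrt (hmin (hgmem y))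
  have hkC : ∀ y, k y ≤ √(K uM) := fun y => Real.sqrt_le_sqrt (hmax (hgmem y))
  obtain ⟨θ, hθd, hθodd, hθmono, hθge⟩ := exists_odd_integral_curve hkc
    (fun y => by simp [hk, hg]) hcpos hck hkC
  have hθ0 : θ 0 = 0 := by have := hθodd 0; rw [neg_zero] at this; linarith
  have hθc : Continuous θ := continuous_iff_continuousAt.2 fun x => (hθd x).continuousAt
  set U : ℝ → ℝ := fun x => g (θ x) with hU
  set W : ℝ → ℝ := fun x =>
    -2 * (Real.sinh (θ x) / Real.cosh (θ x)) * k (θ x) * U x with hW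
  have hUc : Continuous U := hgc.comp hθc
  have hWc : Continuous W := by
    have : Continuous fun x => Real.sinh (θ x) / Real.cosh (θ x) :=
      (Real.continuous_sinh.comp hθc).div (Real.continuous_cosh.comp hθc)
        fun x => (Real.cosh_pos _).ne'
    exact ((continuous_const.mul this).mul (hkc.comp hθc)).mul hUc
  have hUd : ∀ x, HasDerivAt U (W x) x := by
    intro x
    have hcx := (Real.cosh_pos (θ x)).ne'
    have h1 := ((hθd x).cosh.pow 2).inv (pow_ne_zero 2 hcx) |>.const_mul u₀
    refine h1.congr_deriv ?_
    simp only [hW, hU, hg, Pi.pow_apply]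
    field_simp
    norm_num
    ring
  -- Conservation of energy, from `tanh² θ = (u₀ - U)/u₀`.
  have hWsq : ∀ x, W x ^ 2 = 2 * (U x ^ 2 * reducedPotential p (U x)) := by
    intro x
    have hcx := (Real.cosh_pos (θ x)).ne'
    have hksq : k (θ x) ^ 2 = K (U x) := Real.sq_sqrt (hKpos _ (hgmem _)).le
    have hcs := Real.cosh_sq (θ x)
    have hth : (Real.sinh (θ x) / Real.cosh (θ x)) ^ 2 * u₀ = u₀ - U x := by
      simp only [hU, hg]
      field_simp
      rw [hcs]; ring
    have h2 : W x ^ 2 * u₀ = 4 * (u₀ - U x) * K (U x) * U x ^ 2 := by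
      rw [← hth, ← hksq]; simp only [hW]; ring
    have h3 : 2 * (u₀ - U x) * K (U x) = u₀ * reducedPotential p (U x) := by
      rcases eq_or_ne (U x) u₀ with h | h
      · rw [h, hP0]; ring
      · exact hKne _ h
    apply mul_right_cancel₀ hu₀.ne'
    rw [h2]; linear_combination 2 * U x ^ 2 * h3
  have hWne : ∀ x, x ≠ 0 → W x ≠ 0 := by
    intro x hx
    have h1 : θ x ≠ 0 := fun h => hx (hθmono.injective (h.trans hθ0.symm))
    have h2 : Real.sinh (θ x) ≠ 0 := Real.sinh_ne_zero.2 h1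
    exact mul_ne_zero (mul_ne_zero (mul_ne_zero (by norm_num)
      (div_ne_zero h2 (Real.cosh_pos _).ne')) (hcpos.trans_le (hck _)).ne') (hgpos _).ne'
  -- Differentiating the energy identity gives `W' = p(U) U` only where `W ≠ 0`. At `x = 0` the
  -- derivative is recovered from its continuous limit.
  have hWd : ∀ x, HasDerivAt W (p (U x) * U x) x := by
    refine fun x => hasDerivAt_of_hasDerivAt_of_ne' (x := 0) (fun y hy => ?_) hWc.continuousAt
      ((hp.comp hUc).mul hUc).continuousAt x
    refine hasDerivAt_of_hasDerivAt_sq hWc.continuousAt ?_ (hWne y hy)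
    have h1 := ((hasDerivAt_sq_mul_reducedPotential hp (U y)).comp y (hUd y)).const_mul 2
    refine (h1.congr_of_eventuallyEq (Eventually.of_forall hWsq)).congr_deriv ?_
    simp only [Pi.mul_apply, Function.comp_apply]
    ring
  have hdU : deriv U = W := funext fun x => (hUd x).deriv
  have hdW : deriv W = fun x => p (U x) * U x := funext fun x => (hWd x).deriv
  -- From `cosh² θ = 1 + sinh² θ` and `sinh |θ| ≥ |θ| ≥ c|x|`.
  have hUle : ∀ x, U x ≤ u₀ * (1 + (c * x) ^ 2)⁻¹ := by
    intro x
    rw [← div_eq_mul_inv]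
    refine div_le_div_of_nonneg_left hu₀.le (by positivity) ?_
    rw [Real.cosh_sq', add_le_add_iff_left]
    apply sq_le_sq.2
    rw [abs_mul, abs_of_pos hcpos, Real.abs_sinh]
    exact (hθge x).trans (Real.self_le_sinh_iff.2 (abs_nonneg _))
  have hWle : ∀ x, |W x| ≤ 2 * √(K uM) * U x := by
    intro x
    have hcx := Real.cosh_pos (θ x)
    have h1 : |Real.sinh (θ x) / Real.cosh (θ x)| ≤ 1 := by
      rw [abs_div, abs_of_pos hcx, div_le_one hcx, Real.abs_sinh, ← Real.cosh_abs]
      exact (Real.sinh_lt_cosh _).le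
    have h2 : |k (θ x)| ≤ √(K uM) := by
      rw [abs_of_nonneg (Real.sqrt_nonneg _)]; exact hkC _
    have h3 : |U x| = U x := abs_of_pos (hgpos _)
    calc |W x| = 2 * |Real.sinh (θ x) / Real.cosh (θ x)| * |k (θ x)| * U x := by
          simp only [hW]; rw [abs_mul, abs_mul, abs_mul, h3]; norm_num
      _ ≤ 2 * 1 * √(K uM) * U x := by
          have := (hgpos (θ x)).le
          gcongr
      _ = _ := by ring
  refine ⟨U, ?_, fun x => by rw [hdU, hdW], ⟨⟨?_, W, ?_, isWeakDeriv_of_hasDerivAt hUd hWc⟩,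
    fun x => ?_, fun x y hxy => ?_⟩, fun x => hgpos _, fun x => hgle _, ?_⟩
  · have hW1 : ContDiff ℝ 1 W := contDiff_one_iff_deriv.2
      ⟨fun x => (hWd x).differentiableAt, by rw [hdW]; exact (hp.comp hUc).mul hUc⟩
    rw [show (2 : WithTop ℕ∞) = 1 + 1 by norm_num, contDiff_succ_iff_deriv]
    exact ⟨fun x => (hUd x).differentiableAt, by simp, by rwa [hdU]⟩
  · exact memLp_two_of_abs_le_inv_one_add_sq hUc hcpos fun x => by
      rw [abs_of_pos (hgpos _)]; exact hUle x
  · exact memLp_two_of_abs_le_inv_one_add_sq (A := 2 * √(K uM) * u₀) hWc hcpos fun x => by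
      refine (hWle x).trans ?_
      rw [mul_assoc _ u₀]
      gcongr
      exact hUle x
  · simp only [hU, hg, hθodd, Real.cosh_neg]
  · have habs : ∀ x, |θ x| = θ |x| := by
      intro x
      rcases le_total 0 x with h | h
      · rw [abs_of_nonneg h, abs_of_nonneg (hθ0 ▸ hθmono.monotone h)]
      · rw [abs_of_nonpos h, hθodd, abs_of_nonpos (hθ0 ▸ hθmono.monotone h)]
    have h1 : Real.cosh (θ x) ≤ Real.cosh (θ y) := by
      rw [Real.cosh_le_cosh, habs, habs]; exact hθmono.monotone hxy
    have := Real.cosh_pos (θ x)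
    simp only [hU, hg]
    gcongr
  · refine squeeze_zero (fun x => (hgpos _).le) hUle ?_
    have h1 : Tendsto (fun x : ℝ => (c * x) ^ 2) (cocompact ℝ) atTop := by
      have h2 : Tendsto (fun x : ℝ => c * ‖x‖) (cocompact ℝ) atTop :=
        (tendsto_norm_cocompact_atTop (E := ℝ)).const_mul_atTop hcpos
      refine ((tendsto_pow_atTop two_ne_zero).comp h2).congr fun x => ?_
      simp [mul_pow]
    simpa using ((tendsto_inv_atTop_zero.comp
      (tendsto_atTop_add_const_left _ 1 h1)).const_mul u₀)

/-- Existence of a homoclinic solution of `U'' = p(U) U` bounded by `M`. -/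
theorem exists_homoclinic {p : ℝ → ℝ} (hp : Continuous p) (hp0 : 0 < p 0) {M : ℝ} (hM : 0 < M)
    (hPM : reducedPotential p M ≤ 0)
    (hneg : ∀ u, 0 < u → u ≤ M → reducedPotential p u = 0 → p u < 0) :
    ∃ U : ℝ → ℝ, ContDiff ℝ 2 U ∧ (∀ x, deriv (deriv U) x = p (U x) * U x) ∧ MemH1rd U ∧
      (∀ x, 0 < U x) ∧ (∀ x, U x ≤ M) ∧ Tendsto U (cocompact ℝ) (𝓝 0) := by
  obtain ⟨u₀, h0, hle, hP, hlt⟩ := exists_first_zero_reducedPotential hp hp0 hM hPM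
  obtain ⟨U, h1, h2, h3, h4, h5, h6⟩ :=
    exists_homoclinic_of_reducedPotential hp h0 hP hlt (hneg u₀ h0 hle hP)
  exact ⟨U, h1, h2, h3, h4, fun x => (h5 x).trans hle, h6⟩

/-! ### Scalar reduction and power-law branches -/

theorem reducedPotential_soliton {v : ℝ → ℝ} (hv : Continuous v) (α ρ u : ℝ) :
    reducedPotential (fun s => α * (ρ + v s) - s ^ 2) u =
      α * ρ / 2 - u ^ 2 / 4 + α * reducedPotential v u := by
  have h1 : ∀ t : ℝ, t * (α * (ρ + v (t * u)) - (t * u) ^ 2) =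
      α * ρ * t - u ^ 2 * t ^ 3 + α * (t * v (t * u)) := fun t => by ring
  have hv' : Continuous fun t => t * v (t * u) := by fun_prop
  simp only [reducedPotential, h1]
  rw [intervalIntegral.integral_add, intervalIntegral.integral_sub,
    intervalIntegral.integral_const_mul, intervalIntegral.integral_const_mul,
    intervalIntegral.integral_const_mul, integral_id, integral_pow]
  · norm_num; ring
  all_goals exact Continuous.intervalIntegrable (by fun_prop) _ _

theorem reducedPotential_rpow {c q u : ℝ} (hq : 0 < q) (hu : 0 < u) :
    reducedPotential (fun s => c * |s| ^ q) u = c * u ^ q / (q + 2) := by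
  have h : ∀ t ∈ Set.uIcc (0 : ℝ) 1, t * (c * |t * u| ^ q) = c * u ^ q * t ^ (q + 1) := by
    intro t ht
    rw [Set.uIcc_of_le zero_le_one] at ht
    rw [abs_of_nonneg (mul_nonneg ht.1 hu.le), Real.mul_rpow ht.1 hu.le]
    rcases ht.1.eq_or_lt with h0 | h0
    · rw [← h0, Real.zero_rpow (by linarith : q + 1 ≠ 0)]; ring
    · rw [Real.rpow_add_one h0.ne']; ring
  rw [reducedPotential, intervalIntegral.integral_congr h, intervalIntegral.integral_const_mul,
    integral_rpow (Or.inl (by linarith)), Real.one_rpow, Real.zero_rpow (by linarith)]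
  field_simp
  ring

theorem abs_reducedPotential_le {v : ℝ → ℝ} {u ε : ℝ} (hu : 0 ≤ u)
    (hle : ∀ s, 0 ≤ s → s ≤ u → |v s| ≤ ε) : |reducedPotential v u| ≤ ε := by
  have h := intervalIntegral.norm_integral_le_of_norm_le_const (a := 0) (b := 1)
    (f := fun t => t * v (t * u)) (C := ε) fun t ht => by
      rw [Set.uIoc_of_le zero_le_one] at ht
      rw [Real.norm_eq_abs, abs_mul, abs_of_pos ht.1]
      have := hle (t * u) (by nlinarith [ht.1]) (by nlinarith [ht.2])
      exact (mul_le_of_le_one_left (abs_nonneg _) ht.2).trans this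
  simpa [reducedPotential] using h

/-- A positive solution of the scalar equation gives a solution of the system. -/
theorem isBoundState_of_scalar {ρ α a b : ℝ} {v U : ℝ → ℝ} (hv : Continuous v) (hv0 : v 0 = 0)
    (hU : ContDiff ℝ 2 U) (heq : ∀ x, deriv (deriv U) x = (α * (ρ + v (U x)) - U x ^ 2) * U x)
    (hlim : Tendsto U (cocompact ℝ) (𝓝 0))
    (halg : ∀ x, a * v (U x) ^ 2 - b * v (U x) ^ 3 = α * U x ^ 2) :
    IsBoundState ρ α a b U (fun x => v (U x)) where
  contDiff_fst := hU
  continuous_snd := hv.comp hU.continuous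
  schrodinger x := by rw [heq]; ring
  conservation x := by
    simp only [halg]
    have h : DifferentiableAt ℝ (fun y => U y ^ 2) x :=
      ((hU.differentiable (by simp)) x).pow 2
    exact h.hasDerivAt.const_mul α
  tendsto_fst := hlim
  tendsto_snd := by
    have := (hv.tendsto 0).comp hlim
    rwa [hv0] at this

/-- Homoclinic solutions for the power law `V = c U ^ q`. -/
theorem exists_homoclinic_rpow {ρ α c q : ℝ} (hρ : 0 < ρ) (hα : 0 < α) (hq : 0 < q)
    (hq1 : q ≤ 1) :
    ∃ U : ℝ → ℝ, ContDiff ℝ 2 U ∧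
      (∀ x, deriv (deriv U) x = (α * (ρ + c * |U x| ^ q) - U x ^ 2) * U x) ∧ MemH1rd U ∧
      (∀ x, 0 < U x) ∧ Tendsto U (cocompact ℝ) (𝓝 0) := by
  have hv : Continuous fun s : ℝ => c * |s| ^ q :=
    continuous_const.mul (continuous_abs.rpow_const fun _ => Or.inr hq.le)
  have hP : ∀ u, 0 < u → reducedPotential (fun s => α * (ρ + c * |s| ^ q) - s ^ 2) u =
      α * ρ / 2 - u ^ 2 / 4 + α * (c * u ^ q / (q + 2)) := fun u hu => by
    rw [reducedPotential_soliton hv, reducedPotential_rpow hq hu]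
  -- Large enough that `M ^ q ≤ M` and `M²/4` dominates `αρ/2 + α|c|M/2`.
  set M : ℝ := 2 + 2 * α * (ρ + 2 * |c|) with hM
  have hαρ : 0 < α * ρ := mul_pos hα hρ
  have hαc : 0 ≤ α * |c| := mul_nonneg hα.le (abs_nonneg c)
  have hM1 : 2 ≤ M := by rw [hM]; nlinarith
  suffices h : reducedPotential (fun s => α * (ρ + c * |s| ^ q) - s ^ 2) M ≤ 0 ∧
      ∀ u, 0 < u → u ≤ M → reducedPotential (fun s => α * (ρ + c * |s| ^ q) - s ^ 2) u = 0 →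
        α * (ρ + c * |u| ^ q) - u ^ 2 < 0 by
    obtain ⟨U, h1, h2, h3, h4, -, h6⟩ := exists_homoclinic
      ((continuous_const.mul (continuous_const.add hv)).sub (continuous_pow 2))
      (by simpa [Real.zero_rpow hq.ne'] using hαρ) (by linarith) h.1 h.2
    exact ⟨U, h1, h2, h3, h4, h6⟩
  constructor
  · rw [hP M (by linarith)]
    have hw : M ^ q ≤ M := by
      simpa using Real.rpow_le_rpow_of_exponent_le (by linarith : (1 : ℝ) ≤ M) hq1
    have hw0 : 0 ≤ M ^ q := Real.rpow_nonneg (by linarith) q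
    have h5 : c * M ^ q / (q + 2) ≤ |c| * M / 2 := by
      have hcM : c * M ^ q ≤ |c| * M := mul_le_mul (le_abs_self c) hw hw0 (abs_nonneg c)
      rw [div_le_div_iff₀ (by linarith) two_pos]
      nlinarith [mul_nonneg (abs_nonneg c) (by linarith : 0 ≤ M)]
    have h6 := mul_le_mul_of_nonneg_left h5 hα.le
    have h7 : M ^ 2 = 2 * M + 2 * (α * ρ) * M + 4 * (α * |c|) * M := by
      nth_rewrite 1 [sq]
      nth_rewrite 1 [hM]
      ring
    nlinarith
  · intro u hu _ h0
    rw [hP u hu] at h0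
    rw [abs_of_pos hu]
    have hz : c * u ^ q = (q + 2) * (c * u ^ q / (q + 2)) := by field_simp
    set z := c * u ^ q / (q + 2)
    rw [hz]
    have hu2 : 0 < u ^ 2 := by positivity
    have h8 : α * z < u ^ 2 / 4 := by linarith
    -- With `u² = 2αρ + 4αz`, `p(u)` equals both `-αρ - (2 - q)αz` and `qαz - u²/2`; the first form
    -- is negative for `αz ≥ 0`, the second for `αz ≤ 0`.
    rcases le_total 0 (α * z) with h | h
    · nlinarith
    · nlinarith [mul_nonneg hq.le (neg_nonneg.2 h)]

/-! ### Both coefficients positive, small coupling -/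

/-- A continuous function vanishing at `0` and strictly increasing on `[0, ε]` has a continuous
right inverse on its range. -/
theorem exists_continuous_right_inverse {h : ℝ → ℝ} (hc : Continuous h) {ε : ℝ} (hε : 0 < ε)
    (hmono : StrictMonoOn h (Set.Icc 0 ε)) (h0 : h 0 = 0) :
    ∃ w : ℝ → ℝ, Continuous w ∧ w 0 = 0 ∧
      (∀ z, 0 ≤ z → z ≤ h ε → 0 ≤ w z ∧ w z ≤ ε ∧ h (w z) = z) := by
  set κ : ℝ → ℝ := fun y => max 0 (min y ε) with hκ
  have hκmem : ∀ y, κ y ∈ Set.Icc 0 ε := fun y =>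
    ⟨le_max_left _ _, max_le hε.le (min_le_right _ _)⟩
  have hκc : Continuous κ := by fun_prop
  -- Continuing `h` with slope one outside `[0, ε]` gives an increasing bijection of `ℝ`, whose
  -- inverse is continuous everywhere.
  set H : ℝ → ℝ := fun y => h (κ y) + (y - κ y) with hH
  have hHc : Continuous H := by fun_prop
  have hHid : ∀ y ∈ Set.Icc 0 ε, H y = h y := by
    rintro y ⟨hy0, hy1⟩
    have : κ y = y := by simp [hκ, hy0, hy1]
    simp [hH, this]
  have hHmono : StrictMono H := by
    intro x y hxy
    have h1 : κ x ≤ κ y := max_le_max le_rfl (min_le_min hxy.le le_rfl)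
    have h2 : x - κ x ≤ y - κ y := by
      simp only [hκ]
      rcases max_cases 0 (min x ε) with h | h <;> rcases min_cases x ε with h' | h' <;>
        rcases max_cases 0 (min y ε) with h'' | h'' <;> rcases min_cases y ε with h3 | h3 <;>
        linarith
    rcases h1.eq_or_lt with heq | hlt
    · simp only [hH, heq]; linarith
    · exact add_lt_add_of_lt_of_le (hmono (hκmem x) (hκmem y) hlt) h2
  have hbd : ∀ y, 0 ≤ h (κ y) ∧ h (κ y) ≤ h ε := fun y =>
    ⟨h0 ▸ hmono.monotoneOn ⟨le_rfl, hε.le⟩ (hκmem y) (hκmem y).1,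
      hmono.monotoneOn (hκmem y) ⟨hε.le, le_rfl⟩ (hκmem y).2⟩
  have hsurj : Function.Surjective H := by
    refine hHc.surjective ?_ ?_
    · refine tendsto_atTop_mono (fun y => ?_) (tendsto_atTop_add_const_right _ (-ε) tendsto_id)
      have := (hbd y).1; have := (hκmem y).2
      simp only [hH, id]; linarith
    · refine tendsto_atBot_mono (fun y => ?_)
        (tendsto_atBot_add_const_right _ (h ε) tendsto_id)
      have := (hbd y).2; have := (hκmem y).1
      simp only [hH, id]; linarith
  let e := hHmono.orderIsoOfSurjective H hsurj
  have he : ∀ z, H (e.symm z) = z := hHmono.orderIsoOfSurjective_self_symm_apply H hsurj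
  have hH0 : H 0 = 0 := by rw [hHid 0 ⟨le_rfl, hε.le⟩, h0]
  refine ⟨e.symm, e.symm.continuous, hHmono.injective (by rw [he, hH0]), fun z hz hz' => ?_⟩
  have hw0 : 0 ≤ e.symm z := hHmono.le_iff_le.1 (by rwa [he, hH0])
  have hw1 : e.symm z ≤ ε := hHmono.le_iff_le.1 (by rwa [he, hHid ε ⟨hε.le, le_rfl⟩])
  exact ⟨hw0, hw1, by rw [← hHid _ ⟨hw0, hw1⟩, he]⟩

/-- For small coupling, homoclinic solutions with `V = σ w(α U²)`, where `w` inverts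
`y ↦ a y² - σ b y³` near zero. -/
theorem exists_boundState_of_small {ρ a b σ : ℝ} (hρ : 0 < ρ) (ha : 0 < a) (hb : 0 < b)
    (hσ : σ = 1 ∨ σ = -1) :
    ∃ α₀ : ℝ, 0 < α₀ ∧ ∀ α : ℝ, 0 < α → α < α₀ →
      ∃ U V : ℝ → ℝ, IsBoundState ρ α a b U V ∧ MemH1 U ∧ (∀ x, 0 < U x) ∧
        (∀ x, 0 < σ * V x) ∧ ∀ x, a * V x ^ 2 - b * V x ^ 3 = α * U x ^ 2 := by
  set h : ℝ → ℝ := fun y => a * y ^ 2 - σ * b * y ^ 3 with hh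
  have hσ1 : σ ≤ 1 := by rcases hσ with rfl | rfl <;> norm_num
  have hσ2 : σ ^ 2 = 1 := by rcases hσ with rfl | rfl <;> norm_num
  have hσabs : |σ| = 1 := by rcases hσ with rfl | rfl <;> norm_num
  -- The bound `a/(4b)` makes the quadratic term dominate, so `h` increases; `ρ/8` ensures `5ε < ρ`,
  -- needed for nondegeneracy.
  set ε : ℝ := min (ρ / 8) (a / (4 * b)) with hε
  have hε0 : 0 < ε := lt_min (by positivity) (by positivity)
  have hερ : ε ≤ ρ / 8 := min_le_left _ _
  have hεb : b * ε ≤ a / 4 := by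
    calc b * ε ≤ b * (a / (4 * b)) := by gcongr; exact min_le_right _ _
      _ = a / 4 := by field_simp
  have hmono : StrictMonoOn h (Set.Icc 0 ε) := by
    rintro x ⟨hx0, hx1⟩ y ⟨hy0, hy1⟩ hxy
    have hs : 0 < x + y := by linarith
    have h1 : b * (x + y) ≤ a / 2 := by nlinarith
    have h2 : σ * b * (x ^ 2 + x * y + y ^ 2) ≤ a / 2 * (x + y) := by
      calc σ * b * (x ^ 2 + x * y + y ^ 2) ≤ 1 * b * (x ^ 2 + x * y + y ^ 2) := by gcongr
        _ ≤ b * (x + y) * (x + y) := by nlinarith [mul_nonneg hb.le (mul_nonneg hx0 hy0)]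
        _ ≤ _ := by gcongr
    have h3 : 0 < (y - x) * (a * (x + y) - σ * b * (x ^ 2 + x * y + y ^ 2)) :=
      mul_pos (by linarith) (by nlinarith)
    simp only [hh]
    nlinarith
  have h00 : h 0 = 0 := by simp [hh]
  have hhε : 0 < h ε := by
    have := hmono ⟨le_rfl, hε0.le⟩ ⟨hε0.le, le_rfl⟩ hε0
    rwa [h00] at this
  obtain ⟨w, hwc, hw0, hw⟩ := exists_continuous_right_inverse (by fun_prop) hε0 hmono h00
  -- With `M² = 4αρ`, this is the condition `αM² ≤ h ε` that keeps amplitudes up to `M` in the range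
  -- of the inverse.
  refine ⟨√(h ε / (4 * ρ)), Real.sqrt_pos.2 (by positivity), fun α hα hlt => ?_⟩
  have hα2 : 4 * α ^ 2 * ρ ≤ h ε := by
    have := (Real.lt_sqrt hα.le).1 hlt
    rw [lt_div_iff₀ (by positivity)] at this
    linarith
  -- Here `P(M) = α(R - ρ/2)` with `R` the reduced potential of `v` and `|R| ≤ ε`, so `P(M) ≤ 0`.
  set M : ℝ := √(4 * α * ρ) with hM
  have hM0 : 0 < M := Real.sqrt_pos.2 (by positivity)
  have hM2 : M ^ 2 = 4 * α * ρ := Real.sq_sqrt (by positivity)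
  set v : ℝ → ℝ := fun u => σ * w (α * u ^ 2) with hv
  have hvc : Continuous v := by fun_prop
  have hv0 : v 0 = 0 := by simp [hv, hw0]
  have hrange : ∀ u, 0 ≤ u → u ≤ M → α * u ^ 2 ≤ h ε := by
    intro u hu huM
    calc α * u ^ 2 ≤ α * M ^ 2 := by gcongr
      _ ≤ h ε := by rw [hM2]; linarith
  have hvle : ∀ u, 0 ≤ u → u ≤ M → |v u| ≤ ε := by
    intro u hu huM
    obtain ⟨h1, h2, -⟩ := hw (α * u ^ 2) (by positivity) (hrange u hu huM)
    rwa [abs_mul, hσabs, one_mul, abs_of_nonneg h1]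
  have hRle : ∀ u, 0 ≤ u → u ≤ M → |reducedPotential v u| ≤ ε := fun u hu huM =>
    abs_reducedPotential_le hu fun s hs hsu => hvle s hs (hsu.trans huM)
  obtain ⟨U, h1, h2, h3, h4, h5, h6⟩ := exists_homoclinic
    (p := fun s => α * (ρ + v s) - s ^ 2) (M := M) (by fun_prop)
    (by simp only [hv0]; nlinarith [mul_pos hα hρ]) hM0 (by
      rw [reducedPotential_soliton hvc, hM2]
      have := (abs_le.1 (hRle M hM0.le le_rfl)).2
      nlinarith) (by
      intro u hu huM hz
      rw [reducedPotential_soliton hvc] at hz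
      have h7 := (abs_le.1 (hRle u hu.le huM)).1
      have h8 := (abs_le.1 (hvle u hu.le huM)).2
      -- Eliminating `u²` by `P(u) = 0` leaves `p(u) = α(v - 4R - ρ) ≤ α(5ε - ρ) < 0`.
      have h9 : u ^ 2 = 2 * (α * ρ) + 4 * (α * reducedPotential v u) := by linarith
      have : α * (ρ + v u) - u ^ 2 = α * (v u - 4 * reducedPotential v u - ρ) := by
        rw [h9]; ring
      show α * (ρ + v u) - u ^ 2 < 0
      rw [this]
      exact mul_neg_of_pos_of_neg hα (by linarith))
  have hwU : ∀ x, 0 < w (α * U x ^ 2) ∧ h (w (α * U x ^ 2)) = α * U x ^ 2 := by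
    intro x
    have hpos : 0 < α * U x ^ 2 := by have := h4 x; positivity
    obtain ⟨h7, -, h9⟩ := hw _ hpos.le (hrange _ (h4 x).le (h5 x))
    refine ⟨h7.lt_of_ne fun h10 => ?_, h9⟩
    rw [← h10, h00] at h9
    exact hpos.ne h9
  have halg : ∀ x, a * v (U x) ^ 2 - b * v (U x) ^ 3 = α * U x ^ 2 := by
    intro x
    rw [← (hwU x).2]
    simp only [hv, hh]
    linear_combination (a * w (α * U x ^ 2) ^ 2 - b * σ * w (α * U x ^ 2) ^ 3) * hσ2
  refine ⟨U, fun x => v (U x), isBoundState_of_scalar hvc hv0 h1 h2 h6 halg, h3.1, h4,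
    fun x => ?_, halg⟩
  have : σ * v (U x) = w (α * U x ^ 2) := by
    simp only [hv]; linear_combination w (α * U x ^ 2) * hσ2
  rw [this]
  exact (hwU x).1

/-! ### Assembly of the three cases -/

/-- Bound states on a power-law branch `V = c U ^ q`. -/
theorem exists_boundState_rpow {ρ α a b c q : ℝ} (hρ : 0 < ρ) (hα : 0 < α) (hq : 0 < q)
    (hq1 : q ≤ 1)
    (halg : ∀ u : ℝ, 0 < u → a * (c * u ^ q) ^ 2 - b * (c * u ^ q) ^ 3 = α * u ^ 2) :
    ∃ U V : ℝ → ℝ, IsBoundState ρ α a b U V ∧ MemH1rd U ∧ (∀ x, 0 < U x) ∧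
      ∀ x, V x = c * U x ^ q := by
  obtain ⟨U, h1, h2, h3, h4, h5⟩ := exists_homoclinic_rpow (c := c) hρ hα hq hq1
  refine ⟨U, fun x => c * |U x| ^ q, ?_, h3, h4, fun x => by simp only [abs_of_pos (h4 x)]⟩
  refine isBoundState_of_scalar (v := fun s => c * |s| ^ q)
    (continuous_const.mul (continuous_abs.rpow_const fun _ => Or.inr hq.le))
    (by simp [Real.zero_rpow hq.ne']) h1 h2 h5 fun x => ?_
  rw [abs_of_pos (h4 x)]
  exact halg _ (h4 x)

theorem theorem4 (ρ : ℝ) (hρ : 0 < ρ) :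
    -- case `a = 0`, `b > 0`
    (∀ α b : ℝ, 0 < α → 0 < b →
      ∃ U V : ℝ → ℝ, IsBoundState ρ α 0 b U V ∧ MemH1rd U ∧ (∀ x, 0 < U x) ∧
        ∀ x, V x = -((α / b) ^ (1 / 3 : ℝ)) * U x ^ (2 / 3 : ℝ)) ∧
    -- case `a > 0`, `b = 0`
    (∀ α a : ℝ, 0 < α → 0 < a →
      (∃ U₁ V₁ : ℝ → ℝ, IsBoundState ρ α a 0 U₁ V₁ ∧ MemH1rd U₁ ∧ (∀ x, 0 < U₁ x) ∧
        ∀ x, V₁ x = -((α / a) ^ (1 / 2 : ℝ)) * U₁ x) ∧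
      (∃ U₂ V₂ : ℝ → ℝ, IsBoundState ρ α a 0 U₂ V₂ ∧ MemH1rd U₂ ∧ (∀ x, 0 < U₂ x) ∧
        ∀ x, V₂ x = (α / a) ^ (1 / 2 : ℝ) * U₂ x)) ∧
    -- case `a, b > 0`, with `α` small
    (∀ a b : ℝ, 0 < a → 0 < b → ∃ α₀ : ℝ, 0 < α₀ ∧ ∀ α : ℝ, 0 < α → α < α₀ →
      (∃ U₁ V₁ : ℝ → ℝ, IsBoundState ρ α a b U₁ V₁ ∧ MemH1 U₁ ∧
        (∀ x, 0 < U₁ x) ∧ (∀ x, 0 < V₁ x) ∧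
        ∀ x, a * V₁ x ^ 2 - b * V₁ x ^ 3 = α * U₁ x ^ 2) ∧
      (∃ U₂ V₂ : ℝ → ℝ, IsBoundState ρ α a b U₂ V₂ ∧ MemH1 U₂ ∧
        (∀ x, 0 < U₂ x) ∧ (∀ x, V₂ x < 0) ∧
        ∀ x, a * V₂ x ^ 2 - b * V₂ x ^ 3 = α * U₂ x ^ 2)) := by
  refine ⟨fun α b hα hb => ?_, fun α a hα ha => ?_, fun a b ha hb => ?_⟩
  · refine exists_boundState_rpow hρ hα (by norm_num) (by norm_num) fun u hu => ?_
    have h1 : ((α / b) ^ (1 / 3 : ℝ)) ^ 3 = α / b := by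
      rw [← Real.rpow_mul_natCast (by positivity)]; norm_num
    have h2 : (u ^ (2 / 3 : ℝ)) ^ 3 = u ^ 2 := by
      rw [← Real.rpow_mul_natCast hu.le]; norm_num
    calc _ = b * (((α / b) ^ (1 / 3 : ℝ)) ^ 3 * (u ^ (2 / 3 : ℝ)) ^ 3) := by ring
      _ = α * u ^ 2 := by rw [h1, h2]; field_simp
  · have h1 : ((α / a) ^ (1 / 2 : ℝ)) ^ 2 = α / a := by
      rw [← Real.rpow_mul_natCast (by positivity)]; norm_num
    have h2 : ∀ c : ℝ, c ^ 2 = α / a → ∀ u : ℝ, 0 < u →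
        a * (c * u ^ (1 : ℝ)) ^ 2 - 0 * (c * u ^ (1 : ℝ)) ^ 3 = α * u ^ 2 := by
      intro c hc u _
      rw [Real.rpow_one, mul_pow, hc]
      field_simp
      ring
    constructor
    · simpa using exists_boundState_rpow (c := -((α / a) ^ (1 / 2 : ℝ))) hρ hα one_pos le_rfl
        (h2 _ (by rw [neg_sq, h1]))
    · simpa using exists_boundState_rpow hρ hα one_pos le_rfl (h2 _ h1)
  · obtain ⟨α₁, h₁, H₁⟩ := exists_boundState_of_small hρ ha hb (Or.inl rfl)
    obtain ⟨α₂, h₂, H₂⟩ := exists_boundState_of_small hρ ha hb (Or.inr rfl)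
    refine ⟨min α₁ α₂, lt_min h₁ h₂, fun α hα hlt => ⟨?_, ?_⟩⟩
    · simpa using H₁ α hα (hlt.trans_le (min_le_left _ _))
    · simpa using H₂ α hα (hlt.trans_le (min_le_right _ _))
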